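/- A \emph{sublebesgue measure} is a measure $\mu=f(x)\,dx$ on $[0,1]$ with measurable density $f:[0,1]\to[0,1]$. For a binary word $w=w_1\cdots w_k\in\{0,1\}^k$, the density of the pattern $w$ in $\mu$ is $$\rho_w(\mu)=k!\int_{0\le x_1<\dots<x_k\le 1}\ \prod_{i=1}^k g_i(x_i)\,dx_1\cdots dx_k,\qquad g_i=\begin{cases} f & \text{if } w_i=1,\\ 1-f & \text{if } w_i=0;\end{cases}$$ in particular $\rho_1(\mu)=\int_0^1 f(x)\,dx$. \textbf{Theorem.} Let $\tau$ be a finite binary word containing at least one $1$ and at least one $0$, and let $m$ and $n$ be the numbers of $1$s and $0$s in $\tau$. There is a constant $C_\tau\in\mathbb{R}$, depending only on $\tau$, such that for every $\rho\in[0,1]$ $$\{\rho_\tau(\mu) : \mu \text{ a sublebesgue measure with } \rho_1(\mu)=\rho\}=[0,\ C_\tau\,\rho^m(1-\rho)^n].$$ -/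

import Mathlib

open Set MeasureTheory

namespace PatternDensity

/-- `μ` is the sublebesgue measure `f(x) dx` on `[0,1]`: it is absolutely continuous with respect
to Lebesgue measure on `[0,1]`, with the measurable density `f` taking values in `[0,1]`. -/
structure IsSublebesgue (μ : Measure ℝ) (f : ℝ → ℝ) : Prop where
  measurable : Measurable f
  mem_Icc : ∀ x ∈ Icc (0 : ℝ) 1, f x ∈ Icc (0 : ℝ) 1
  eq_withDensity : μ = (volume.restrict (Icc (0 : ℝ) 1)).withDensity fun x => ENNReal.ofReal (f x)

/-- The ordered simplex `0 ≤ x₁ < ⋯ < x_k ≤ 1`. -/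
def orderedSimplex (k : ℕ) : Set (Fin k → ℝ) :=
  {x | (∀ i, x i ∈ Icc (0 : ℝ) 1) ∧ StrictMono x}

/-- The factor `f(x)` for the letter `1` (`true`), and `1 - f(x)` for the letter `0` (`false`). -/
def letterFactor (f : ℝ → ℝ) (b : Bool) (x : ℝ) : ℝ :=
  if b = true then f x else 1 - f x

/-- The density `ρ_w` of the binary word `w` (`true` is `1`, `false` is `0`) in the sublebesgue
measure `f(x) dx`. -/
noncomputable def patternDensity (w : List Bool) (f : ℝ → ℝ) : ℝ :=
  (w.length.factorial : ℝ) *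
    ∫ x in orderedSimplex w.length, ∏ i : Fin w.length, letterFactor f (w.get i) (x i)

/-- The set `E_W ⊆ [0,1]^k` of feasible tuples of densities of the words `W 0, …, W (k - 1)`. -/
def feasibleSet {k : ℕ} (W : Fin k → List Bool) : Set (Fin k → ℝ) :=
  {δ | (∀ i, δ i ∈ Icc (0 : ℝ) 1) ∧
    ∃ (μ : Measure ℝ) (f : ℝ → ℝ), IsSublebesgue μ f ∧ ∀ i, patternDensity (W i) f = δ i}

end PatternDensity

/-!
Draw one point for each letter of `τ`, from the normalised law of `f(x) dx` for a `1` and from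
that of `(1 - f(x)) dx` for a `0`. Up to the factor `k! ρ^m (1 - ρ)^n`, the density of `τ` is the
probability that these points come in increasing order. Only the order of the points matters, so
both laws may be pushed forward by the distribution function of any atomless mixture of them: this
turns that mixture into Lebesgue measure. Hence every pair of atomless laws arises, up to such a
push-forward, from a density of mean `ρ`, whatever `ρ ∈ (0,1)` is, and the largest probability
depends on `τ` only. It is attained because the pairs with a prescribed mixture form a weakly
compact set, on which the probability is continuous. At the other end, a threshold function with
the `1`s and the `0`s on the wrong sides has pattern density zero, and the intermediate value
theorem on the segment joining two densities of mean `ρ` fills the interval.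
-/

namespace PatternDensity

open Filter Topology ProbabilityTheory
open scoped NNReal ENNReal

variable {X : Type*} {k : ℕ}

theorem prod_get_eq_pow_count {R : Type*} [CommMonoid R] (l : List Bool) (c : Bool → R) :
    ∏ i, c (l.get i) = c true ^ l.count true * c false ^ l.count false :=
  calc
    ∏ i, c (l.get i) = ∏ b ∈ l.toFinset, c b ^ l.count b :=
      (Fin.prod_univ_fun_getElem l c).trans (Finset.prod_list_map_count l c)
    _ = ∏ b, c b ^ l.count b := Finset.prod_subset (Finset.subset_univ _) fun b _ hb => by
      rw [List.count_eq_zero.2 (mt List.mem_toFinset.2 hb), pow_zero]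
    _ = c true ^ l.count true * c false ^ l.count false := Fintype.prod_bool _

section Pi

variable [MeasurableSpace X]

theorem pi_nnreal_smul {ι : Type*} [Fintype ι] (c : ι → ℝ≥0) (μ : ι → Measure X)
    [∀ i, SigmaFinite (μ i)] :
    Measure.pi (fun i => c i • μ i) = (∏ i, c i) • Measure.pi μ :=
  Measure.pi_eq fun s _ => by
    simp only [Measure.smul_apply, Measure.pi_pi, ENNReal.smul_def, ENNReal.ofNNReal_finsetProd,
      smul_eq_mul, Finset.prod_mul_distrib]

theorem pi_withDensity_ofReal {ι : Type*} [Fintype ι] (μ : ι → Measure X)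
    [∀ i, SigmaFinite (μ i)] {g : ι → X → ℝ}
    (hg : ∀ i, Integrable (g i) (μ i)) (hg0 : ∀ i, 0 ≤ᵐ[μ i] g i) :
    Measure.pi (fun i => (μ i).withDensity fun x => ENNReal.ofReal (g i x)) =
      (Measure.pi μ).withDensity fun x => ENNReal.ofReal (∏ i, g i (x i)) := by
  have (i : ι) : IsFiniteMeasure ((μ i).withDensity fun x => ENNReal.ofReal (g i x)) :=
    isFiniteMeasure_withDensity_ofReal (hg i).2
  have hnonneg : ∀ᵐ x ∂Measure.pi μ, 0 ≤ ∏ i, g i (x i) := by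
    filter_upwards [eventually_all.2 fun i => Measure.tendsto_eval_ae_ae.eventually (hg0 i)]
      with x hx
    exact Finset.prod_nonneg fun i _ => hx i
  refine Measure.pi_eq fun s hs => ?_
  have hint : IntegrableOn (fun x => ∏ i, g i (x i)) (univ.pi s) (Measure.pi μ) := by
    rw [IntegrableOn, Measure.restrict_pi_pi]
    exact Integrable.fintype_prod fun i => (hg i).integrableOn
  calc
    (Measure.pi μ).withDensity (fun x => ENNReal.ofReal (∏ i, g i (x i))) (univ.pi s)
      = ENNReal.ofReal (∫ x in univ.pi s, ∏ i, g i (x i) ∂Measure.pi μ) := by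
      rw [withDensity_apply _ (MeasurableSet.univ_pi hs),
        ofReal_integral_eq_lintegral_ofReal hint (ae_restrict_of_ae hnonneg)]
    _ = ∏ i, ENNReal.ofReal (∫ x in s i, g i x ∂μ i) := by
      rw [Measure.restrict_pi_pi, integral_fintype_prod_eq_prod,
        ENNReal.ofReal_prod_of_nonneg fun i _ =>
          integral_nonneg_of_ae (ae_restrict_of_ae (hg0 i))]
    _ = ∏ i, (μ i).withDensity (fun x => ENNReal.ofReal (g i x)) (s i) :=
      Finset.prod_congr rfl fun i _ => by
        rw [withDensity_apply _ (hs i), ofReal_integral_eq_lintegral_ofReal (hg i).integrableOn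
          (ae_restrict_of_ae (hg0 i))]

theorem exists_withDensity_ofReal_eq_of_le {μ κ : Measure X} [IsFiniteMeasure κ] (hμ : μ ≤ κ) :
    ∃ f : X → ℝ, Measurable f ∧ (∀ x, f x ∈ Icc (0 : ℝ) 1) ∧
      κ.withDensity (fun x => ENNReal.ofReal (f x)) = μ := by
  have hfin : IsFiniteMeasure μ := isFiniteMeasure_of_le _ hμ
  -- The derivative is at most `1` only almost everywhere, hence the truncation.
  let f (x : X) : ℝ := (min (μ.rnDeriv κ x) 1).toReal
  have hf : Measurable f :=
    ((Measure.measurable_rnDeriv _ _).min measurable_const).ennreal_toReal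
  have hf01 (x : X) : f x ∈ Icc (0 : ℝ) 1 :=
    ⟨ENNReal.toReal_nonneg, ENNReal.toReal_le_of_le_ofReal zero_le_one (by simp)⟩
  refine ⟨f, hf, hf01, ?_⟩
  rw [← Measure.withDensity_rnDeriv_eq μ κ (Measure.absolutelyContinuous_of_le hμ)]
  refine withDensity_congr_ae ?_
  filter_upwards [Measure.rnDeriv_le_one_of_le hμ] with x hx
  have hx' : min (μ.rnDeriv κ x) 1 = μ.rnDeriv κ x := min_eq_left hx
  simp only [f, hx', ENNReal.ofReal_toReal (ne_top_of_le_ne_top ENNReal.one_ne_top hx)]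

theorem nullSingletonClass_of_absolutelyContinuous {μ κ : Measure X} [NullSingletonClass κ]
    (h : μ ≪ κ) : NullSingletonClass μ :=
  ⟨fun x => h (measure_singleton x)⟩

variable [MeasurableEq X] (μ : Fin k → Measure X) [∀ i, SigmaFinite (μ i)]

theorem pi_setOf_eq_null {i j : Fin k} [NullSingletonClass (μ j)] (hij : i ≠ j) :
    Measure.pi μ {x | x i = x j} = 0 := by
  cases k with
  | zero => exact i.elim0
  | succ k =>
    obtain ⟨l, rfl⟩ := Fin.exists_succAbove_eq hij.symm
    have hmeas : MeasurableSet {p : X × (Fin k → X) | p.1 = p.2 l} :=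
      measurableSet_eq_fun (by fun_prop) (by fun_prop)
    refine ((measurePreserving_piFinSuccAbove μ i).measure_preimage
      hmeas.nullMeasurableSet).trans ?_
    refine (Measure.measure_prod_null hmeas).2 (.of_forall fun y => ?_)
    simp only [preimage_ofPred_eq, eq_comm (a := y)]
    exact Measure.pi_hyperplane (fun m => μ (i.succAbove m)) l y

theorem ae_injective_pi [∀ i, NullSingletonClass (μ i)] :
    ∀ᵐ x ∂Measure.pi μ, Function.Injective x := by
  have hne (i j : Fin k) (hij : i ≠ j) : ∀ᵐ x ∂Measure.pi μ, x i ≠ x j :=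
    measure_eq_zero_iff_ae_notMem.1 (pi_setOf_eq_null μ hij)
  filter_upwards [eventually_all.2 fun i => eventually_all.2 fun j => eventually_all.2 (hne i j)]
    with x hx i j
  exact not_imp_not.1 (hx i j)

end Pi

section IncreasingMass

/-- The mass of the increasing tuples under the product of the measures `μ i`. When the `μ i` are
probability measures, this is the probability that independent points with these laws come in
increasing order. -/
noncomputable def increasingMass [MeasurableSpace X] [Preorder X] (μ : Fin k → Measure X) : ℝ :=
  (Measure.pi μ).real {x | StrictMono x}

section Preorder

variable [MeasurableSpace X] [Preorder X] (μ : Fin k → Measure X)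

theorem increasingMass_nonneg : 0 ≤ increasingMass μ :=
  measureReal_nonneg

theorem increasingMass_of_subsingleton [Subsingleton (Fin k)] [∀ i, SigmaFinite (μ i)] :
    increasingMass μ = ∏ i, (μ i).real univ := by
  have huniv : {x : Fin k → X | StrictMono x} = univ :=
    eq_univ_of_forall fun x => Subsingleton.strictMono x
  simp only [increasingMass, huniv, measureReal_def, Measure.pi_univ, ENNReal.toReal_prod]

theorem increasingMass_nnreal_smul (c : Fin k → ℝ≥0) [∀ i, SigmaFinite (μ i)] :
    increasingMass (fun i => c i • μ i) = (∏ i, (c i : ℝ)) * increasingMass μ := by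
  rw [increasingMass, pi_nnreal_smul, measureReal_nnreal_smul_apply, NNReal.coe_prod,
    increasingMass]

end Preorder

variable [LinearOrder X] [TopologicalSpace X] [OrderClosedTopology X]

theorem isOpen_setOf_strictMono : IsOpen {x : Fin k → X | StrictMono x} := by
  simp only [StrictMono, ofPred_forall]
  exact isOpen_iInter_of_finite fun i => isOpen_iInter_of_finite fun j =>
    isOpen_iInter_of_finite fun _ => isOpen_lt (continuous_apply i) (continuous_apply j)

variable [SecondCountableTopology X] [MeasurableSpace X] [OpensMeasurableSpace X]

theorem measurableSet_setOf_strictMono : MeasurableSet {x : Fin k → X | StrictMono x} :=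
  isOpen_setOf_strictMono.measurableSet

theorem pi_frontier_setOf_strictMono (μ : Fin k → Measure X) [∀ i, SigmaFinite (μ i)]
    [∀ i, NullSingletonClass (μ i)] : Measure.pi μ (frontier {x | StrictMono x}) = 0 := by
  have hclosure : closure {x : Fin k → X | StrictMono x} ⊆ {x | Monotone x} :=
    closure_minimal (fun _ hx => hx.monotone) isClosed_monotone
  rw [isOpen_setOf_strictMono.frontier_eq, measure_eq_zero_iff_ae_notMem]
  filter_upwards [ae_injective_pi μ] with x hinj hx
  exact hx.2 ((hclosure hx.1).strictMono_of_injective hinj)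

theorem increasingMass_map_of_monotone {Y : Type*} [LinearOrder Y] [MeasurableSpace Y] {H : Y → X}
    (hH : Monotone H) (hHm : Measurable H) (μ : Fin k → Measure Y) [∀ i, IsFiniteMeasure (μ i)]
    [∀ i, NullSingletonClass ((μ i).map H)] :
    increasingMass (fun i => (μ i).map H) = increasingMass μ := by
  have hmeas : Measurable fun (x : Fin k → Y) i => H (x i) := by fun_prop
  have hpi : Measure.pi (fun i => (μ i).map H) = (Measure.pi μ).map fun x i => H (x i) :=
    (Measure.pi_map_pi fun _ => hHm.aemeasurable).symm
  have hinj : ∀ᵐ x ∂Measure.pi μ, Function.Injective fun i => H (x i) :=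
    ae_of_ae_map hmeas.aemeasurable (hpi ▸ ae_injective_pi fun i => (μ i).map H)
  rw [increasingMass, hpi, map_measureReal_apply hmeas measurableSet_setOf_strictMono]
  refine measureReal_congr ?_
  filter_upwards [hinj] with x hx
  exact propext ⟨fun h i j hij => hH.reflect_lt (h hij),
    fun h => (hH.comp h.monotone).strictMono_of_injective hx⟩

theorem continuousAt_increasingMass [TopologicalSpace.PseudoMetrizableSpace X]
    {p : Fin k → ProbabilityMeasure X} [∀ i, NullSingletonClass (p i : Measure X)] :
    ContinuousAt
      (fun q : Fin k → ProbabilityMeasure X => increasingMass fun i => (q i : Measure X)) p :=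
  (ENNReal.tendsto_toReal (measure_ne_top _ _)).comp <|
    ProbabilityMeasure.tendsto_measure_of_null_frontier_of_tendsto'
      (ProbabilityMeasure.continuous_pi.tendsto p)
      (pi_frontier_setOf_strictMono fun i => (p i : Measure X))

theorem pi_real_setOf_strictMono_comp_perm (μ : Measure X) [SigmaFinite μ]
    (σ : Equiv.Perm (Fin k)) :
    (Measure.pi fun _ => μ).real {x | StrictMono (x ∘ σ)} = increasingMass fun _ : Fin k => μ := by
  have hcomp (x : Fin k → X) : MeasurableEquiv.piCongrLeft (fun _ => X) σ.symm x = x ∘ σ := by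
    ext i
    simpa only [MeasurableEquiv.coe_piCongrLeft, Equiv.symm_apply_apply, Function.comp_apply] using
      Equiv.piCongrLeft_apply_apply (fun _ => X) σ.symm x (σ i)
  simpa only [preimage_ofPred_eq, hcomp, increasingMass] using
    (measurePreserving_piCongrLeft (fun _ : Fin k => μ) σ.symm).measureReal_preimage
      measurableSet_setOf_strictMono.nullMeasurableSet

theorem factorial_mul_increasingMass_le_one (μ : Measure X) [IsProbabilityMeasure μ] (k : ℕ) :
    k.factorial * increasingMass (fun _ : Fin k => μ) ≤ 1 := by
  let S (σ : Equiv.Perm (Fin k)) : Set (Fin k → X) := {x | StrictMono (x ∘ σ)}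
  have hmeas (σ : Equiv.Perm (Fin k)) : MeasurableSet (S σ) :=
    measurableSet_setOf_strictMono.preimage (by fun_prop : Measurable fun x : Fin k → X => x ∘ σ)
  have hdisj : Pairwise (Function.onFun Disjoint S) := by
    refine fun σ σ' hne => disjoint_left.2 fun x (hσ : StrictMono _) (hσ' : StrictMono _) => hne ?_
    have hinj : Function.Injective x := (Equiv.injective_comp σ x).1 hσ.injective
    exact Equiv.ext fun i => hinj (congrFun (Tuple.unique_monotone hσ.monotone hσ'.monotone) i)
  calc
    k.factorial * increasingMass (fun _ : Fin k => μ)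
      = ∑ σ, (Measure.pi fun _ => μ).real (S σ) := by
      simp only [S, pi_real_setOf_strictMono_comp_perm, Finset.sum_const, Finset.card_univ,
        Fintype.card_perm, Fintype.card_fin, nsmul_eq_mul]
    _ = (Measure.pi fun _ => μ).real (⋃ σ, S σ) := (measureReal_iUnion_fintype hdisj hmeas).symm
    _ ≤ 1 := measureReal_le_one

end IncreasingMass

section Cdf

/-- Lebesgue measure on `[0,1]`, the law of a uniform point. -/
noncomputable def lebesgueIcc : Measure ℝ := volume.restrict (Icc (0 : ℝ) 1)

instance : IsProbabilityMeasure lebesgueIcc := ⟨by simp [lebesgueIcc]⟩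

instance : NullSingletonClass lebesgueIcc :=
  inferInstanceAs (NullSingletonClass (volume.restrict (Icc (0 : ℝ) 1)))

theorem lebesgueIcc_real_Icc {a b : ℝ} (ha : 0 ≤ a) (hab : a ≤ b) (hb : b ≤ 1) :
    lebesgueIcc.real (Icc a b) = b - a := by
  rw [lebesgueIcc, measureReal_restrict_apply measurableSet_Icc,
    inter_eq_left.2 (Icc_subset_Icc ha hb), Real.volume_real_Icc_of_le hab]

theorem lebesgueIcc_real_Iic {y : ℝ} (hy : y ∈ Icc (0 : ℝ) 1) : lebesgueIcc.real (Iic y) = y := by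
  have hIic : Iic y ∩ Icc 0 1 = Icc 0 y ∩ Icc 0 1 := by
    ext x
    simp only [mem_inter_iff, mem_Iic, mem_Icc]
    tauto
  have h := lebesgueIcc_real_Icc le_rfl hy.1 hy.2
  rwa [lebesgueIcc, measureReal_restrict_apply measurableSet_Icc, ← hIic,
    ← measureReal_restrict_apply measurableSet_Iic, sub_zero] at h

variable (μ : Measure ℝ) [IsProbabilityMeasure μ]

theorem measureReal_Iic_eq_of_forall_mem_Ioo (h : ∀ y ∈ Ioo (0 : ℝ) 1, μ.real (Iic y) = y)
    (y : ℝ) : μ.real (Iic y) = max 0 (min 1 y) := by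
  have hmono {y z : ℝ} (hyz : y ≤ z) : μ.real (Iic y) ≤ μ.real (Iic z) :=
    measureReal_mono (Iic_subset_Iic.2 hyz)
  rcases le_or_gt y 0 with hy0 | hy0
  · rw [min_eq_right (hy0.trans zero_le_one), max_eq_left hy0]
    refine le_antisymm (le_of_forall_gt_imp_ge_of_dense fun z hz => ?_) measureReal_nonneg
    rcases lt_or_ge z 1 with hz1 | hz1
    · exact (hmono (hy0.trans hz.le)).trans_eq (h z ⟨hz, hz1⟩)
    · exact measureReal_le_one.trans hz1
  rcases lt_or_ge y 1 with hy1 | hy1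
  · rw [min_eq_right hy1.le, max_eq_right hy0.le, h y ⟨hy0, hy1⟩]
  · rw [min_eq_left hy1, max_eq_right zero_le_one]
    refine le_antisymm measureReal_le_one (le_of_forall_lt_imp_le_of_dense fun z hz => ?_)
    rcases le_or_gt z 0 with hz0 | hz0
    · exact hz0.trans measureReal_nonneg
    · exact (h z ⟨hz0, hz⟩).symm.trans_le (hmono (hz.le.trans hy1))

theorem eq_lebesgueIcc_of_forall_mem_Ioo (h : ∀ y ∈ Ioo (0 : ℝ) 1, μ.real (Iic y) = y) :
    μ = lebesgueIcc := by
  refine Measure.eq_of_cdf _ _ (StieltjesFunction.ext fun y => ?_)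
  rw [cdf_eq_real, cdf_eq_real, measureReal_Iic_eq_of_forall_mem_Ioo μ h,
    measureReal_Iic_eq_of_forall_mem_Ioo lebesgueIcc fun y hy =>
      lebesgueIcc_real_Iic (Ioo_subset_Icc_self hy)]

variable [NullSingletonClass μ]

theorem continuous_cdf : Continuous (cdf μ) := by
  refine continuous_iff_continuousAt.2 fun x => ?_
  rw [(monotone_cdf μ).continuousAt_iff_leftLim_eq_rightLim, StieltjesFunction.rightLim_eq]
  have hjump : ENNReal.ofReal (cdf μ x - Function.leftLim (cdf μ) x) = 0 := by
    rw [← StieltjesFunction.measure_singleton, measure_cdf, measure_singleton]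
  exact ((monotone_cdf μ).leftLim_le le_rfl).antisymm
    (sub_nonpos.1 (ENNReal.ofReal_eq_zero.1 hjump))

theorem Ioo_subset_range_cdf : Ioo 0 1 ⊆ range (cdf μ) := fun _ hy =>
  mem_range_of_exists_le_of_exists_ge (continuous_cdf μ)
    ((tendsto_cdf_atBot μ).eventually_le_const hy.1).exists
    ((tendsto_cdf_atTop μ).eventually_const_le hy.2).exists

theorem measureReal_cdf_preimage_Iic {y : ℝ} (hy : y ∈ Ioo (0 : ℝ) 1) :
    μ.real (cdf μ ⁻¹' Iic y) = y := by
  refine le_antisymm (le_of_forall_gt_imp_ge_of_dense fun z hz => ?_) ?_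
  · rcases lt_or_ge z 1 with hz1 | hz1
    · obtain ⟨x, rfl⟩ := Ioo_subset_range_cdf μ ⟨hy.1.trans hz, hz1⟩
      rw [cdf_eq_real]
      exact measureReal_mono fun w (hw : cdf μ w ≤ y) =>
        ((monotone_cdf μ).reflect_lt (hw.trans_lt hz)).le
    · exact measureReal_le_one.trans hz1
  · obtain ⟨x, rfl⟩ := Ioo_subset_range_cdf μ hy
    nth_rw 1 [cdf_eq_real]
    exact measureReal_mono fun w (hw : w ≤ x) => monotone_cdf μ hw

theorem map_cdf_eq_lebesgueIcc : μ.map (cdf μ) = lebesgueIcc := by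
  have hmeas : Measurable (cdf μ) := (continuous_cdf μ).measurable
  have := Measure.isProbabilityMeasure_map (μ := μ) hmeas.aemeasurable
  refine eq_lebesgueIcc_of_forall_mem_Ioo _ fun y hy => ?_
  rw [map_measureReal_apply hmeas measurableSet_Iic, measureReal_cdf_preimage_Iic μ hy]

end Cdf

section Mixtures

variable [MeasurableSpace X] {β : Type*} [Fintype β]

/-- The families of probability measures whose mixture with weights `c` is `κ`. -/
def mixtures (c : β → ℝ≥0) (κ : Measure X) : Set (β → ProbabilityMeasure X) :=
  {p | ∑ b, c b • (p b : Measure X) = κ}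

theorem smul_le_of_mem_mixtures {c : β → ℝ≥0} {κ : Measure X} {p : β → ProbabilityMeasure X}
    (hp : p ∈ mixtures c κ) (b : β) : c b • (p b : Measure X) ≤ κ :=
  (Finset.single_le_sum (f := fun b => c b • (p b : Measure X)) (fun _ _ => Measure.zero_le _)
    (Finset.mem_univ b)).trans_eq hp

theorem le_inv_smul_of_mem_mixtures {c : β → ℝ≥0} {κ : Measure X} {p : β → ProbabilityMeasure X}
    (hp : p ∈ mixtures c κ) {b : β} (hb : c b ≠ 0) : (p b : Measure X) ≤ (c b)⁻¹ • κ := by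
  simpa only [smul_smul, inv_mul_cancel₀ hb, one_smul] using
    smul_le_smul_left (c b)⁻¹ (smul_le_of_mem_mixtures hp b)

theorem nullSingletonClass_of_mem_mixtures {c : β → ℝ≥0} {κ : Measure X} [NullSingletonClass κ]
    {p : β → ProbabilityMeasure X} (hp : p ∈ mixtures c κ) {b : β} (hb : c b ≠ 0) :
    NullSingletonClass (p b : Measure X) :=
  nullSingletonClass_of_absolutelyContinuous <|
    (le_inv_smul_of_mem_mixtures hp hb).absolutelyContinuous.trans
      Measure.smul_absolutelyContinuous

variable [TopologicalSpace X] [BorelSpace X]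

theorem isClosed_mixtures [HasOuterApproxClosed X] (c : β → ℝ≥0) (κ : Measure X)
    [IsFiniteMeasure κ] : IsClosed (mixtures c κ) := by
  let κ' : FiniteMeasure X := ⟨κ, inferInstance⟩
  have hcont : Continuous fun p : β → ProbabilityMeasure X => ∑ b, c b • (p b).toFiniteMeasure :=
    continuous_finsetSum _ fun b _ =>
      (ProbabilityMeasure.toFiniteMeasure_continuous.comp (continuous_apply b)).const_smul (c b)
  convert isClosed_singleton (x := κ').preimage hcont using 1
  ext p
  rw [mem_preimage, mem_singleton_iff, ← FiniteMeasure.toMeasure_injective.eq_iff,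
    FiniteMeasure.toMeasure_sum]
  rfl

theorem isTightMeasureSet_of_forall_le [TopologicalSpace.IsCompletelyPseudoMetrizableSpace X]
    [SecondCountableTopology X] {κ : Measure X} [IsFiniteMeasure κ]
    {S : Set (Measure X)} (hS : ∀ μ ∈ S, μ ≤ κ) : IsTightMeasureSet S := by
  have hκ := isTightMeasureSet_singleton (μ := κ)
  rw [isTightMeasureSet_iff_exists_isCompact_measure_compl_le] at hκ ⊢
  intro ε hε
  obtain ⟨K, hK, hle⟩ := hκ ε hε
  exact ⟨K, hK, fun μ hμ => (hS μ hμ _).trans (hle κ rfl)⟩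

theorem isCompact_mixtures [PolishSpace X] {c : β → ℝ≥0} (hc : ∀ b, c b ≠ 0)
    (κ : Measure X) [IsFiniteMeasure κ] : IsCompact (mixtures c κ) := by
  let K (b : β) : Set (ProbabilityMeasure X) := {p | (p : Measure X) ≤ (c b)⁻¹ • κ}
  have hK (b : β) : IsCompact (closure (K b)) :=
    isCompact_closure_of_isTightMeasureSet <| isTightMeasureSet_of_forall_le (κ := (c b)⁻¹ • κ) <|
      by rintro _ ⟨p, hp, rfl⟩; exact hp
  exact (isCompact_univ_pi hK).of_isClosed_subset (isClosed_mixtures c κ) fun p hp b _ =>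
    subset_closure (le_inv_smul_of_mem_mixtures hp (hc b))

end Mixtures

section Maximum

variable {β : Type*}

theorem exists_mem_mixtures_increasingMass_eq [Fintype β] {c : β → ℝ≥0} (hc : ∀ b, c b ≠ 0)
    (hsum : ∑ b, c b = 1) (p : β → ProbabilityMeasure ℝ)
    [∀ b, NullSingletonClass (p b : Measure ℝ)] (w : Fin k → β) :
    ∃ q ∈ mixtures c lebesgueIcc, increasingMass (fun i => (q (w i) : Measure ℝ)) =
      increasingMass fun i => (p (w i) : Measure ℝ) := by
  let κ : Measure ℝ := ∑ b, c b • (p b : Measure ℝ)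
  have hκ1 : IsProbabilityMeasure κ := ⟨by
    simp only [κ, Measure.coe_finsetSum, Finset.sum_apply, Measure.smul_apply, measure_univ,
      ENNReal.smul_def, smul_eq_mul, mul_one]
    exact_mod_cast hsum⟩
  have hκ0 : NullSingletonClass κ := ⟨fun x => by simp [κ]⟩
  have hmeas : Measurable (cdf κ) := (continuous_cdf κ).measurable
  let q (b : β) : ProbabilityMeasure ℝ := (p b).map hmeas.aemeasurable
  have hq : q ∈ mixtures c lebesgueIcc := by
    rw [← map_cdf_eq_lebesgueIcc κ]
    exact ((Measure.map_finset_sum hmeas.aemeasurable).trans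
      (Finset.sum_congr rfl fun b _ => Measure.map_smul _ _ _)).symm
  have hq0 (b : β) : NullSingletonClass ((p b : Measure ℝ).map (cdf κ)) :=
    nullSingletonClass_of_mem_mixtures hq (hc b)
  exact ⟨q, hq, increasingMass_map_of_monotone (monotone_cdf κ) hmeas fun i => p (w i)⟩

theorem exists_forall_increasingMass_le [Finite β] [Nonempty β] (w : Fin k → β) :
    ∃ p : β → ProbabilityMeasure ℝ, (∀ b, NullSingletonClass (p b : Measure ℝ)) ∧
      ∀ q : β → ProbabilityMeasure ℝ, (∀ b, NullSingletonClass (q b : Measure ℝ)) →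
        increasingMass (fun i => (q (w i) : Measure ℝ)) ≤
          increasingMass fun i => (p (w i) : Measure ℝ) := by
  have := Fintype.ofFinite β
  let c (_ : β) : ℝ≥0 := (Fintype.card β : ℝ≥0)⁻¹
  have hc (b : β) : c b ≠ 0 := inv_ne_zero (Nat.cast_ne_zero.2 Fintype.card_ne_zero)
  have hsum : ∑ b, c b = 1 := by simp [c]
  have hne : (mixtures c lebesgueIcc).Nonempty := by
    refine ⟨fun _ => ⟨lebesgueIcc, inferInstance⟩, ?_⟩
    change ∑ b, c b • lebesgueIcc = lebesgueIcc
    rw [← Finset.sum_smul, hsum, one_smul]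
  have hcont : ContinuousOn
      (fun p : β → ProbabilityMeasure ℝ => increasingMass fun i => (p (w i) : Measure ℝ))
      (mixtures c lebesgueIcc) := by
    intro p hp
    have hnull (i : Fin k) : NullSingletonClass (p (w i) : Measure ℝ) :=
      nullSingletonClass_of_mem_mixtures hp (hc (w i))
    have hreindex : Continuous fun (q : β → ProbabilityMeasure ℝ) i => q (w i) := by fun_prop
    exact ((continuousAt_increasingMass (p := fun i => p (w i))).comp
      (f := fun (q : β → ProbabilityMeasure ℝ) i => q (w i))
      hreindex.continuousAt).continuousWithinAt
  obtain ⟨p, hp, hmax⟩ := (isCompact_mixtures hc lebesgueIcc).exists_isMaxOn hne hcont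
  refine ⟨p, fun b => nullSingletonClass_of_mem_mixtures hp (hc b), fun q hq => ?_⟩
  obtain ⟨q', hq', heq⟩ := exists_mem_mixtures_increasingMass_eq hc hsum q w
  exact heq.symm.trans_le (hmax hq')

theorem exists_eq_smul_probabilityMeasure (ν : Measure ℝ) [IsFiniteMeasure ν]
    [NullSingletonClass ν] : ∃ p : ProbabilityMeasure ℝ, NullSingletonClass (p : Measure ℝ) ∧
      ν = (ν univ).toNNReal • (p : Measure ℝ) := by
  rcases eq_or_ne ν 0 with rfl | hν
  · exact ⟨⟨lebesgueIcc, inferInstance⟩, inferInstanceAs (NullSingletonClass lebesgueIcc), by simp⟩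
  let ν' : FiniteMeasure ℝ := ⟨ν, inferInstance⟩
  have hν' : ν' ≠ 0 := fun h => hν (congrArg FiniteMeasure.toMeasure h)
  refine ⟨ν'.normalize, ?_, congrArg FiniteMeasure.toMeasure ν'.self_eq_mass_smul_normalize⟩
  rw [ν'.toMeasure_normalize_eq_of_nonzero hν']
  exact nullSingletonClass_of_absolutelyContinuous (κ := ν) Measure.smul_absolutelyContinuous

theorem increasingMass_le_mul_of_forall_le {w : Fin k → β} {M : ℝ}
    (hM : ∀ q : β → ProbabilityMeasure ℝ, (∀ b, NullSingletonClass (q b : Measure ℝ)) →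
      increasingMass (fun i => (q (w i) : Measure ℝ)) ≤ M)
    (ν : β → Measure ℝ) [∀ b, IsFiniteMeasure (ν b)] [∀ b, NullSingletonClass (ν b)] :
    increasingMass (fun i => ν (w i)) ≤ (∏ i, (ν (w i)).real univ) * M := by
  choose p hp heq using fun b => exists_eq_smul_probabilityMeasure (ν b)
  calc
    increasingMass (fun i => ν (w i))
      = increasingMass (fun i => (ν (w i) univ).toNNReal • (p (w i) : Measure ℝ)) :=
        congrArg increasingMass (funext fun i => heq (w i))
    _ = (∏ i, (ν (w i)).real univ) * increasingMass (fun i => (p (w i) : Measure ℝ)) :=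
      increasingMass_nnreal_smul _ _
    _ ≤ (∏ i, (ν (w i)).real univ) * M := by
      gcongr
      exact hM p hp

end Maximum

section Densities

/-- The measurable functions that take values in `[0,1]` on `[0,1]`, that is, the densities of the
sublebesgue measures. -/
def sublebesgueDensities : Set (ℝ → ℝ) :=
  {f | Measurable f ∧ ∀ x ∈ Icc (0 : ℝ) 1, f x ∈ Icc (0 : ℝ) 1}

/-- The sublebesgue measure `f(x) dx`. -/
noncomputable def densityMeasure (f : ℝ → ℝ) : Measure ℝ :=
  lebesgueIcc.withDensity fun x => ENNReal.ofReal (f x)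

instance (f : ℝ → ℝ) : NullSingletonClass (densityMeasure f) :=
  inferInstanceAs (NullSingletonClass (lebesgueIcc.withDensity _))

theorem ae_mem_Icc_lebesgueIcc : ∀ᵐ x ∂lebesgueIcc, x ∈ Icc (0 : ℝ) 1 :=
  ae_restrict_mem measurableSet_Icc

variable {f g : ℝ → ℝ}

theorem ae_mem_Icc_of_mem_sublebesgueDensities (hf : f ∈ sublebesgueDensities) :
    ∀ᵐ x ∂lebesgueIcc, f x ∈ Icc (0 : ℝ) 1 :=
  ae_mem_Icc_lebesgueIcc.mono hf.2

theorem integrable_of_mem_sublebesgueDensities (hf : f ∈ sublebesgueDensities) :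
    Integrable f lebesgueIcc :=
  .of_mem_Icc 0 1 hf.1.aemeasurable (ae_mem_Icc_of_mem_sublebesgueDensities hf)

theorem convex_sublebesgueDensities : Convex ℝ sublebesgueDensities :=
  fun _ hf _ hg _ _ ha hb hab => ⟨(hf.1.const_smul _).add (hg.1.const_smul _),
    fun x hx => convex_Icc 0 1 (hf.2 x hx) (hg.2 x hx) ha hb hab⟩

theorem letterFactor_mem_Icc {x : ℝ} (hx : f x ∈ Icc (0 : ℝ) 1) (b : Bool) :
    letterFactor f b x ∈ Icc (0 : ℝ) 1 := by
  cases b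
  · exact Icc.mem_iff_one_sub_mem.1 hx
  · exact hx

theorem letterFactor_mem_sublebesgueDensities (hf : f ∈ sublebesgueDensities) (b : Bool) :
    letterFactor f b ∈ sublebesgueDensities := by
  refine ⟨?_, fun x hx => letterFactor_mem_Icc (hf.2 x hx) b⟩
  cases b
  · exact hf.1.const_sub 1
  · exact hf.1

theorem isFiniteMeasure_densityMeasure (hf : f ∈ sublebesgueDensities) :
    IsFiniteMeasure (densityMeasure f) :=
  isFiniteMeasure_withDensity_ofReal (integrable_of_mem_sublebesgueDensities hf).2

theorem densityMeasure_real_univ (hf : f ∈ sublebesgueDensities) :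
    (densityMeasure f).real univ = ∫ x, f x ∂lebesgueIcc := by
  rw [measureReal_def, densityMeasure, withDensity_apply _ MeasurableSet.univ,
    Measure.restrict_univ, integral_eq_lintegral_of_nonneg_ae
      ((ae_mem_Icc_of_mem_sublebesgueDensities hf).mono fun _ hx => hx.1)
      hf.1.aestronglyMeasurable]

theorem integral_letterFactor (hf : f ∈ sublebesgueDensities) (b : Bool) :
    ∫ x, letterFactor f b x ∂lebesgueIcc =
      bif b then ∫ x, f x ∂lebesgueIcc else 1 - ∫ x, f x ∂lebesgueIcc := by
  cases b
  · change ∫ x, (1 - f x) ∂lebesgueIcc = 1 - ∫ x, f x ∂lebesgueIcc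
    rw [integral_sub (integrable_const 1) (integrable_of_mem_sublebesgueDensities hf),
      integral_const, probReal_univ, one_smul]
  · rfl

theorem sum_densityMeasure_letterFactor (hf : f ∈ sublebesgueDensities) :
    ∑ b, densityMeasure (letterFactor f b) = lebesgueIcc := by
  have hmeas (b : Bool) := (letterFactor_mem_sublebesgueDensities hf b).1
  have hone : ((fun x => ENNReal.ofReal (letterFactor f true x)) +
      fun x => ENNReal.ofReal (letterFactor f false x)) =ᵐ[lebesgueIcc] 1 := by
    filter_upwards [ae_mem_Icc_of_mem_sublebesgueDensities hf] with x hx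
    rw [Pi.add_apply, ← ENNReal.ofReal_add (letterFactor_mem_Icc hx true).1
      (letterFactor_mem_Icc hx false).1]
    simp [letterFactor]
  rw [Fintype.sum_bool, densityMeasure, densityMeasure,
    ← withDensity_add_left (hmeas true).ennreal_ofReal, withDensity_congr_ae hone,
    withDensity_one]

theorem exists_densityMeasure_letterFactor_eq {ν : Bool → Measure ℝ}
    (hν : ∑ b, ν b = lebesgueIcc) :
    ∃ f ∈ sublebesgueDensities, ∀ b, densityMeasure (letterFactor f b) = ν b := by
  have hle : ν true ≤ lebesgueIcc := by
    rw [← hν, Fintype.sum_bool]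
    exact Measure.le_add_right le_rfl
  obtain ⟨f, hfm, hf01, heq⟩ := exists_withDensity_ofReal_eq_of_le hle
  have hf : f ∈ sublebesgueDensities := ⟨hfm, fun x _ => hf01 x⟩
  change densityMeasure f = ν true at heq
  have hfin : IsFiniteMeasure (densityMeasure f) := isFiniteMeasure_densityMeasure hf
  have hsum : densityMeasure f + densityMeasure (letterFactor f false) =
      densityMeasure f + ν false := by
    rw [Fintype.sum_bool, ← heq] at hν
    exact ((Fintype.sum_bool _).symm.trans (sum_densityMeasure_letterFactor hf)).trans hν.symm
  refine ⟨f, hf, fun b => ?_⟩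
  cases b
  · exact (Measure.add_right_inj _ _ _).1 hsum
  · exact heq

end Densities

section Patterns

variable {f g : ℝ → ℝ}

theorem volume_restrict_orderedSimplex (k : ℕ) :
    (volume : Measure (Fin k → ℝ)).restrict (orderedSimplex k) =
      (Measure.pi fun _ => lebesgueIcc).restrict {x : Fin k → ℝ | StrictMono x} := by
  have hinter : orderedSimplex k = {x | StrictMono x} ∩ univ.pi fun _ => Icc 0 1 := by
    ext x
    simp only [orderedSimplex, mem_ofPred_eq, mem_inter_iff, mem_univ_pi, and_comm]
  rw [hinter, ← Measure.restrict_restrict measurableSet_setOf_strictMono, volume_pi,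
    Measure.restrict_pi_pi]
  rfl

theorem ae_prod_letterFactor_mem_Icc (hf : f ∈ sublebesgueDensities) (τ : List Bool) :
    ∀ᵐ x ∂Measure.pi fun _ : Fin τ.length => lebesgueIcc,
      ∏ i, letterFactor f (τ.get i) (x i) ∈ Icc (0 : ℝ) 1 := by
  filter_upwards [eventually_all.2 fun i : Fin τ.length =>
    Measure.tendsto_eval_ae_ae.eventually (ae_mem_Icc_of_mem_sublebesgueDensities hf)] with x hx
  have hmem (i : Fin τ.length) := letterFactor_mem_Icc (hx i) (τ.get i)
  exact ⟨Finset.prod_nonneg fun i _ => (hmem i).1,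
    Finset.prod_le_one (fun i _ => (hmem i).1) fun i _ => (hmem i).2⟩

theorem aestronglyMeasurable_prod_letterFactor (hf : f ∈ sublebesgueDensities) (τ : List Bool)
    (μ : Measure (Fin τ.length → ℝ)) :
    AEStronglyMeasurable (fun x => ∏ i, letterFactor f (τ.get i) (x i)) μ :=
  (Finset.measurable_prod _ fun i _ => (letterFactor_mem_sublebesgueDensities hf _).1.comp
    (measurable_pi_apply i)).aestronglyMeasurable

theorem patternDensity_eq (hf : f ∈ sublebesgueDensities) (τ : List Bool) :
    patternDensity τ f = τ.length.factorial *
      increasingMass fun i => densityMeasure (letterFactor f (τ.get i)) := by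
  have hletter (i : Fin τ.length) := letterFactor_mem_sublebesgueDensities hf (τ.get i)
  have hpi := pi_withDensity_ofReal (fun _ : Fin τ.length => lebesgueIcc)
    (fun i => integrable_of_mem_sublebesgueDensities (hletter i))
    fun i => (ae_mem_Icc_of_mem_sublebesgueDensities (hletter i)).mono fun _ hx => hx.1
  simp only [patternDensity, volume_restrict_orderedSimplex, increasingMass, densityMeasure]
  rw [hpi, measureReal_def, withDensity_apply _ measurableSet_setOf_strictMono,
    integral_eq_lintegral_of_nonneg_ae
      (ae_restrict_of_ae ((ae_prod_letterFactor_mem_Icc hf τ).mono fun _ hx => hx.1))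
      (aestronglyMeasurable_prod_letterFactor hf τ _)]

theorem patternDensity_nonneg (hf : f ∈ sublebesgueDensities) (τ : List Bool) :
    0 ≤ patternDensity τ f := by
  rw [patternDensity_eq hf]
  exact mul_nonneg (Nat.cast_nonneg _) (increasingMass_nonneg _)

theorem patternDensity_le_one (hf : f ∈ sublebesgueDensities) (τ : List Bool) :
    patternDensity τ f ≤ 1 := by
  have hae := ae_restrict_of_ae (s := {x | StrictMono x}) (ae_prod_letterFactor_mem_Icc hf τ)
  have hint : ∫ x in orderedSimplex τ.length, ∏ i, letterFactor f (τ.get i) (x i) ≤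
      increasingMass fun _ : Fin τ.length => lebesgueIcc := by
    rw [volume_restrict_orderedSimplex]
    refine (integral_mono_of_nonneg (hae.mono fun _ hx => hx.1) (integrable_const 1)
      (hae.mono fun _ hx => hx.2)).trans_eq ?_
    rw [setIntegral_const, smul_eq_mul, mul_one, increasingMass]
  calc
    patternDensity τ f
      ≤ τ.length.factorial * increasingMass fun _ : Fin τ.length => lebesgueIcc := by
      rw [patternDensity]
      gcongr
    _ ≤ 1 := factorial_mul_increasingMass_le_one lebesgueIcc τ.length

theorem patternDensity_true (hf : f ∈ sublebesgueDensities) :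
    patternDensity [true] f = ∫ x, f x ∂lebesgueIcc := by
  have hfin (i : Fin [true].length) :
      IsFiniteMeasure (densityMeasure (letterFactor f ([true].get i))) :=
    isFiniteMeasure_densityMeasure (letterFactor_mem_sublebesgueDensities hf _)
  have : Subsingleton (Fin [true].length) := inferInstanceAs (Subsingleton (Fin 1))
  rw [patternDensity_eq hf, increasingMass_of_subsingleton]
  simp only [densityMeasure_real_univ (letterFactor_mem_sublebesgueDensities hf _)]
  simp [letterFactor]

theorem continuousOn_patternDensity_lineMap (hf : f ∈ sublebesgueDensities)
    (hg : g ∈ sublebesgueDensities) (τ : List Bool) :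
    ContinuousOn (fun t : ℝ => patternDensity τ (AffineMap.lineMap f g t)) (Icc 0 1) := by
  have hmem {t : ℝ} (ht : t ∈ Icc 0 1) : AffineMap.lineMap f g t ∈ sublebesgueDensities :=
    convex_sublebesgueDensities.lineMap_mem hf hg ht
  simp only [patternDensity, volume_restrict_orderedSimplex]
  refine continuousOn_const.mul <| continuousOn_of_dominated (bound := fun _ => 1)
    (fun t ht => aestronglyMeasurable_prod_letterFactor (hmem ht) τ _) (fun t ht => ?_)
    (integrable_const 1) (.of_forall fun x => Continuous.continuousOn ?_)
  · filter_upwards [ae_restrict_of_ae (ae_prod_letterFactor_mem_Icc (hmem ht) τ)] with x hx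
    exact (Real.norm_of_nonneg hx.1).trans_le hx.2
  · refine continuous_finsetProd _ fun i _ => ?_
    simp only [letterFactor, AffineMap.lineMap_apply_module', Pi.add_apply, Pi.smul_apply,
      Pi.sub_apply]
    split_ifs <;> fun_prop

end Patterns

section Mean

/-- The densities of the sublebesgue measures of mass `ρ`. -/
def densitiesOfMean (ρ : ℝ) : Set (ℝ → ℝ) :=
  {f ∈ sublebesgueDensities | ∫ x, f x ∂lebesgueIcc = ρ}

variable {τ : List Bool} {ρ : ℝ}

theorem convex_densitiesOfMean (ρ : ℝ) : Convex ℝ (densitiesOfMean ρ) := by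
  refine fun f hf g hg a b ha hb hab => ⟨convex_sublebesgueDensities hf.1 hg.1 ha hb hab, ?_⟩
  rw [integral_add' ((integrable_of_mem_sublebesgueDensities hf.1).smul a)
    ((integrable_of_mem_sublebesgueDensities hg.1).smul b)]
  simp only [Pi.smul_apply, integral_smul, hf.2, hg.2, ← add_smul, hab, one_smul]

theorem ordConnected_image_densitiesOfMean (τ : List Bool) (ρ : ℝ) :
    OrdConnected (patternDensity τ '' densitiesOfMean ρ) := by
  refine ⟨?_⟩
  rintro _ ⟨f, hf, rfl⟩ _ ⟨g, hg, rfl⟩ δ hδ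
  obtain ⟨t, ht, rfl⟩ := intermediate_value_Icc zero_le_one
    (continuousOn_patternDensity_lineMap hf.1 hg.1 τ) (by simpa using hδ)
  exact ⟨_, (convex_densitiesOfMean ρ).lineMap_mem hf hg ht, rfl⟩

theorem setOf_mem_feasibleSet (hρ : ρ ∈ Icc (0 : ℝ) 1) (τ : List Bool) :
    {δ : ℝ | ![ρ, δ] ∈ feasibleSet ![[true], τ]} = patternDensity τ '' densitiesOfMean ρ := by
  ext δ
  constructor
  · rintro ⟨-, μ, f, hμ, hW⟩
    have hf : f ∈ sublebesgueDensities := ⟨hμ.measurable, hμ.mem_Icc⟩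
    exact ⟨f, ⟨hf, (patternDensity_true hf).symm.trans (hW 0)⟩, hW 1⟩
  · rintro ⟨f, ⟨hf, rfl⟩, rfl⟩
    exact ⟨Fin.forall_fin_two.2 ⟨hρ, patternDensity_nonneg hf τ, patternDensity_le_one hf τ⟩,
      densityMeasure f, f, ⟨hf.1, hf.2, rfl⟩, Fin.forall_fin_two.2 ⟨patternDensity_true hf, rfl⟩⟩

theorem indicator_mem_densitiesOfMean {s : Set ℝ} (hs : MeasurableSet s) :
    s.indicator 1 ∈ densitiesOfMean (lebesgueIcc.real s) :=
  ⟨⟨measurable_one.indicator hs, fun _ _ => ⟨indicator_nonneg (fun _ _ => zero_le_one) _,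
    indicator_le_self' (fun _ _ => zero_le_one) _⟩⟩, integral_indicator_one hs⟩

theorem patternDensity_indicator_eq_zero {s : Set ℝ} {i j : Fin τ.length}
    (hi : τ.get i = true) (hj : τ.get j = false)
    (hs : ∀ x ∈ orderedSimplex τ.length, x i ∈ s → x j ∈ s) :
    patternDensity τ (s.indicator 1) = 0 := by
  rw [patternDensity, setIntegral_eq_zero_of_forall_eq_zero, mul_zero]
  intro x hx
  by_cases hxi : x i ∈ s
  · refine Finset.prod_eq_zero (Finset.mem_univ j) ?_
    rw [hj]
    simp [letterFactor, hs x hx hxi]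
  · refine Finset.prod_eq_zero (Finset.mem_univ i) ?_
    rw [hi]
    simp [letterFactor, hxi]

theorem isLeast_zero_image_densitiesOfMean (h1 : true ∈ τ) (h0 : false ∈ τ)
    (hρ : ρ ∈ Icc (0 : ℝ) 1) : IsLeast (patternDensity τ '' densitiesOfMean ρ) 0 := by
  refine ⟨?_, forall_mem_image.2 fun f hf => patternDensity_nonneg hf.1 τ⟩
  obtain ⟨i, hi⟩ := List.mem_iff_get.1 h1
  obtain ⟨j, hj⟩ := List.mem_iff_get.1 h0
  have hij : i ≠ j := by
    rintro rfl
    exact Bool.noConfusion (hi.symm.trans hj)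
  rcases lt_or_gt_of_ne hij with hij | hij
  · have hmass : lebesgueIcc.real (Icc (1 - ρ) 1) = ρ := by
      rw [lebesgueIcc_real_Icc (sub_nonneg.2 hρ.2) (sub_le_self 1 hρ.1) le_rfl, sub_sub_cancel]
    refine ⟨_, hmass ▸ indicator_mem_densitiesOfMean measurableSet_Icc,
      patternDensity_indicator_eq_zero hi hj fun x hx hxi => ?_⟩
    exact ⟨hxi.1.trans (hx.2 hij).le, (hx.1 j).2⟩
  · have hmass : lebesgueIcc.real (Icc 0 ρ) = ρ := by
      rw [lebesgueIcc_real_Icc le_rfl hρ.1 hρ.2, sub_zero]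
    refine ⟨_, hmass ▸ indicator_mem_densitiesOfMean measurableSet_Icc,
      patternDensity_indicator_eq_zero hi hj fun x hx hxi => ?_⟩
    exact ⟨(hx.1 j).1, (hx.2 hij).le.trans hxi.2⟩

theorem patternDensity_le_of_forall_increasingMass_le {M : ℝ}
    (hM : ∀ q : Bool → ProbabilityMeasure ℝ, (∀ b, NullSingletonClass (q b : Measure ℝ)) →
      increasingMass (fun i => (q (τ.get i) : Measure ℝ)) ≤ M)
    {f : ℝ → ℝ} (hf : f ∈ densitiesOfMean ρ) :
    patternDensity τ f ≤
      τ.length.factorial * M * ρ ^ τ.count true * (1 - ρ) ^ τ.count false := by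
  have hletter (b : Bool) := letterFactor_mem_sublebesgueDensities hf.1 b
  have hfin (b : Bool) : IsFiniteMeasure (densityMeasure (letterFactor f b)) :=
    isFiniteMeasure_densityMeasure (hletter b)
  have hmass : ∏ i, (densityMeasure (letterFactor f (τ.get i))).real univ =
      ρ ^ τ.count true * (1 - ρ) ^ τ.count false := by
    simp only [densityMeasure_real_univ (hletter _), integral_letterFactor hf.1, hf.2]
    exact prod_get_eq_pow_count τ fun b => bif b then ρ else 1 - ρ
  have hle := increasingMass_le_mul_of_forall_le hM fun b => densityMeasure (letterFactor f b)
  rw [hmass] at hle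
  calc
    patternDensity τ f
      ≤ τ.length.factorial * (ρ ^ τ.count true * (1 - ρ) ^ τ.count false * M) := by
      rw [patternDensity_eq hf.1]
      gcongr
    _ = τ.length.factorial * M * ρ ^ τ.count true * (1 - ρ) ^ τ.count false := by ring

theorem exists_patternDensity_eq_of_mem_Ioo (τ : List Bool) (hρ : ρ ∈ Ioo (0 : ℝ) 1)
    (p : Bool → ProbabilityMeasure ℝ) [∀ b, NullSingletonClass (p b : Measure ℝ)] :
    ∃ f ∈ densitiesOfMean ρ, patternDensity τ f =
      τ.length.factorial * increasingMass (fun i => (p (τ.get i) : Measure ℝ)) *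
        ρ ^ τ.count true * (1 - ρ) ^ τ.count false := by
  let c (b : Bool) : ℝ≥0 := bif b then ⟨ρ, hρ.1.le⟩ else ⟨1 - ρ, sub_nonneg.2 hρ.2.le⟩
  have hc : ∀ b, c b ≠ 0 :=
    Bool.forall_bool.2 ⟨NNReal.ne_iff.1 (sub_pos.2 hρ.2).ne', NNReal.ne_iff.1 hρ.1.ne'⟩
  have hsum : ∑ b, c b = 1 := by
    rw [Fintype.sum_bool]
    exact NNReal.eq (add_sub_cancel ρ 1)
  obtain ⟨q, hq, hqp⟩ := exists_mem_mixtures_increasingMass_eq hc hsum p τ.get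
  obtain ⟨f, hf, hfq⟩ := exists_densityMeasure_letterFactor_eq hq
  refine ⟨f, ⟨hf, ?_⟩, ?_⟩
  · have htrue : densityMeasure f = c true • (q true : Measure ℝ) := hfq true
    rw [← densityMeasure_real_univ hf, htrue, measureReal_nnreal_smul_apply, probReal_univ,
      mul_one]
    rfl
  · rw [patternDensity_eq hf]
    simp only [hfq]
    rw [increasingMass_nnreal_smul _ fun i => c (τ.get i), hqp,
      prod_get_eq_pow_count τ fun b => (c b : ℝ)]
    change _ * (ρ ^ τ.count true * (1 - ρ) ^ τ.count false * _) = _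
    ring

theorem exists_isGreatest_image_densitiesOfMean (h1 : true ∈ τ) (h0 : false ∈ τ) :
    ∃ C : ℝ, ∀ ρ ∈ Icc (0 : ℝ) 1, IsGreatest (patternDensity τ '' densitiesOfMean ρ)
      (C * ρ ^ τ.count true * (1 - ρ) ^ τ.count false) := by
  obtain ⟨p, hp, hmax⟩ := exists_forall_increasingMass_le τ.get
  refine ⟨τ.length.factorial * increasingMass fun i => (p (τ.get i) : Measure ℝ), fun ρ hρ =>
    ⟨?_, forall_mem_image.2 fun f hf => patternDensity_le_of_forall_increasingMass_le hmax hf⟩⟩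
  by_cases hρ' : ρ ∈ Ioo 0 1
  · exact exists_patternDensity_eq_of_mem_Ioo τ hρ' p
  have hzero : ρ ^ τ.count true * (1 - ρ) ^ τ.count false = 0 := by
    rcases eq_endpoints_or_mem_Ioo_of_mem_Icc hρ with rfl | rfl | hmem
    · rw [zero_pow (List.count_pos_iff.2 h1).ne', zero_mul]
    · rw [sub_self, zero_pow (List.count_pos_iff.2 h0).ne', mul_zero]
    · exact absurd hmem hρ'
  rw [mul_assoc, hzero, mul_zero]
  exact (isLeast_zero_image_densitiesOfMean h1 h0 hρ).1

end Mean

end PatternDensity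

theorem mainTheorem2 (τ : List Bool) (h1 : true ∈ τ) (h0 : false ∈ τ) :
    ∃ C : ℝ, ∀ ρ ∈ Set.Icc (0 : ℝ) 1,
      {δ : ℝ | ![ρ, δ] ∈ PatternDensity.feasibleSet ![[true], τ]} =
        Set.Icc 0 (C * ρ ^ τ.count true * (1 - ρ) ^ τ.count false) := by
  obtain ⟨C, hC⟩ := PatternDensity.exists_isGreatest_image_densitiesOfMean h1 h0
  refine ⟨C, fun ρ hρ => ?_⟩
  have hleast := PatternDensity.isLeast_zero_image_densitiesOfMean h1 h0 hρ
  have hgreatest := hC ρ hρ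
  rw [PatternDensity.setOf_mem_feasibleSet hρ]
  exact subset_antisymm (fun δ hδ => ⟨hleast.2 hδ, hgreatest.2 hδ⟩)
    ((PatternDensity.ordConnected_image_densitiesOfMean τ ρ).out hleast.1 hgreatest.1)
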